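/- For positive integers $m\le n$, an $(n,m)$-permutation is a sequence $\nu=(\nu(1),\dots,\nu(m))$ of distinct elements of $\{1,\dots,n\}$. Its corresponding generalized permuton $\mu_\nu$ is the probability measure on $\mathbb R^2$ with density equal to $n^2/m$ on $\bigcup_{h=1}^m \left[\frac{h-1}{n},\frac hn\right)\times\left[\frac{\nu(h)-1}{n},\frac{\nu(h)}{n}\right)$ and $0$ elsewhere; the marginal distribution functions $F_x,F_y$ of $\nu$ are those of $\mu_\nu$. For a permutation $\tau$ of $\{1,\dots,k\}$, $k\ge 1$, the density $t(\tau,\nu)$ is, for $k\le m$, the number of $x_1<\dots<x_k$ in $\{1,\dots,m\}$ such that, for all $i,j$, $\nu(x_i)<\nu(x_j)\iff\tau(i)<\tau(j)$, divided by $\binom mk$. For $0<\lambda\le 1$, a $\lambda$-permuton is a probability measure $\mu$ concentrated on $[0,\lambda]\times[0,1]$ with first marginal distribution function $F_x(x)=x/\lambda$ on $[0,\lambda]$ and continuous second marginal distribution function $F_y$ satisfying $F_y(b)-F_y(a)\le (b-a)/\lambda$ for $0\le a<b\le 1$; a generalized permuton is a $\lambda$-permuton for some $\lambda\in(0,1]$.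 For a generalized permuton $\mu$ and a permutation $\tau$ of $\{1,\dots,k\}$, $t(\tau,\mu)$ is the probability that, for independent points $(\xi_1,\eta_1),\dots,(\xi_k,\eta_k)$ with law $\mu$ and ordered coordinates $\xi_1^*<\dots<\xi_k^*$, $\eta_1^*<\dots<\eta_k^*$, for every $i$ the point with first coordinate $\xi_i^*$ has second coordinate $\eta^*_{\tau(i)}$. For generalized permutons, $\mu_n\xrightarrow{t}\mu$ means that $t(\tau,\mu_n)\to t(\tau,\mu)$ for every permutation $\tau$ (of every order $k\ge1$) and that the two marginal distribution functions of $\mu_n$ converge weakly to those of $\mu$. Let $(m_n)_{n\ge 1}$ be positive integers with $m_n\le n$, $m_n\to\infty$ and $m_n/n\to\lambda>0$. For each $n\ge1$ let $\nu_n$ be an $(n,m_n)$-permutation and let $\mu_n=\mu_{\nu_n}$. Call $(\nu_n)$ convergent if for every permutation $\tau$ the sequence $t(\tau,\nu_n)$ converges and the marginal distribution functions $F_x^{(n)}$ and $F_y^{(n)}$ of $\nu_n$ converge pointwise as $n\to\infty$. Then $(\nu_n)$ is convergent if and only if $\mu_n\xrightarrow{t}\mu$ for some $\lambda$-permuton $\mu$.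 -/

import Mathlib

open Filter Topology MeasureTheory ProbabilityTheory

namespace OrderedSelection

/-- An `(n,m)`-permutation: an ordered selection `(ν(1), …, ν(m))` of `m` distinct elements of
`{1, …, n}`. Places and values are indexed from `0`, so `ν h` with `h : Fin m` is
`ν(h+1) - 1` in one-based notation. -/
abbrev NMPerm (n m : ℕ) : Type := Fin m ↪ Fin n

/-- The grid square `[h/n, (h+1)/n) × [l/n, (l+1)/n)` (with `h`, `l` counted from `0`). -/
def gridSquare (n h l : ℕ) : Set (ℝ × ℝ) :=
  Set.Ico ((h : ℝ) / n) (((h : ℝ) + 1) / n) ×ˢ Set.Ico ((l : ℝ) / n) (((l : ℝ) + 1) / n)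

/-- The density `f_ν`: equal to `n² / m` on the squares picked by `ν`, and `0` elsewhere. -/
noncomputable def selDensity {n m : ℕ} (ν : NMPerm n m) : ℝ × ℝ → ℝ :=
  Set.indicator (⋃ h : Fin m, gridSquare n h (ν h)) (fun _ => (n : ℝ) ^ 2 / (m : ℝ))

/-- The generalized permuton `μ_ν` corresponding to `ν`: the measure on the plane with
density `f_ν`. -/
noncomputable def permutonOf {n m : ℕ} (ν : NMPerm n m) : Measure (ℝ × ℝ) :=
  volume.withDensity (fun p => ENNReal.ofReal (selDensity ν p))

/-- First marginal distribution function `F_x` of a probability measure on the plane. -/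
noncomputable def margX (μ : Measure (ℝ × ℝ)) : ℝ → ℝ := fun x => cdf (μ.map Prod.fst) x

/-- Second marginal distribution function `F_y` of a probability measure on the plane. -/
noncomputable def margY (μ : Measure (ℝ × ℝ)) : ℝ → ℝ := fun y => cdf (μ.map Prod.snd) y

/-- `μ` is a `lam`-permuton. -/
structure IsLambdaPermuton (lam : ℝ) (μ : Measure (ℝ × ℝ)) : Prop where
  isProbabilityMeasure : IsProbabilityMeasure μ
  pos : 0 < lam
  le_one : lam ≤ 1
  concentrated : μ (Set.Icc 0 lam ×ˢ Set.Icc 0 1)ᶜ = 0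
  margX_eq : ∀ x ∈ Set.Icc 0 lam, margX μ x = x / lam
  margY_continuous : Continuous (margY μ)
  margY_slope : ∀ a b : ℝ, 0 ≤ a → a < b → b ≤ 1 → margY μ b - margY μ a ≤ (b - a) / lam

/-- The permutation read off from the sample points `p 0, …, p (k-1)` is `σ`. Here `ξ* = ξ ∘ a`
and `η* = η ∘ b` are the strictly ordered samples of first and second coordinates, and for each
rank `i` the point `l = a i` with `ξ_l = ξ*_i` satisfies `η_l = η*_{σ(i)}`, i.e. `l = b (σ i)`. -/
def HasPattern {k : ℕ} (p : Fin k → ℝ × ℝ) (σ : Equiv.Perm (Fin k)) : Prop :=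
  ∃ a b : Equiv.Perm (Fin k),
    StrictMono (fun i => (p (a i)).1) ∧ StrictMono (fun j => (p (b j)).2) ∧
      ∀ i, a i = b (σ i)

/-- Density of `τ` in `μ`: the probability that `k` independent points with law `μ` have
pattern `τ`. -/
noncomputable def densityPermuton {k : ℕ} (τ : Equiv.Perm (Fin k)) (μ : Measure (ℝ × ℝ)) : ℝ :=
  (Measure.pi (fun _ : Fin k => μ)).real {p | HasPattern p τ}

/-- Number of occurrences of `τ` in `ν`. -/
noncomputable def occurrences {k n m : ℕ} (τ : Equiv.Perm (Fin k)) (ν : NMPerm n m) : ℕ :=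
  Set.ncard {x : Fin k → Fin m | StrictMono x ∧ ∀ i j, ν (x i) < ν (x j) ↔ τ i < τ j}

/-- Density of `τ` in `ν` (meant for `k ≤ m`). -/
noncomputable def densitySel {k n m : ℕ} (τ : Equiv.Perm (Fin k)) (ν : NMPerm n m) : ℝ :=
  (occurrences τ ν : ℝ) / (m.choose k : ℝ)

/-- Weak convergence of distribution functions: convergence at every continuity point of the
limit. -/
def WeakConv (F : ℕ → ℝ → ℝ) (G : ℝ → ℝ) : Prop :=
  ∀ x, ContinuousAt G x → Tendsto (fun n => F n x) atTop (𝓝 (G x))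

/-- Convergence `μ_n →_t μ` in the sense of permutation densities. -/
def TConv (μs : ℕ → Measure (ℝ × ℝ)) (μ : Measure (ℝ × ℝ)) : Prop :=
  (∀ k : ℕ, 1 ≤ k → ∀ τ : Equiv.Perm (Fin k),
      Tendsto (fun n => densityPermuton τ (μs n)) atTop (𝓝 (densityPermuton τ μ))) ∧
    WeakConv (fun n => margX (μs n)) (margX μ) ∧
    WeakConv (fun n => margY (μs n)) (margY μ)

/-- Convergence of a sequence of `(n, m_n)`-permutations: every pattern density converges, and the
marginal distribution functions (by definition those of `μ_{ν_n}`) converge pointwise. -/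
def IsConvergent {m : ℕ → ℕ} (ν : ∀ n, NMPerm n (m n)) : Prop :=
  (∀ k : ℕ, 1 ≤ k → ∀ τ : Equiv.Perm (Fin k),
      ∃ c : ℝ, Tendsto (fun n => densitySel τ (ν n)) atTop (𝓝 c)) ∧
    (∃ G : ℝ → ℝ, ∀ x, Tendsto (fun n => margX (permutonOf (ν n)) x) atTop (𝓝 (G x))) ∧
    (∃ G : ℝ → ℝ, ∀ y, Tendsto (fun n => margY (permutonOf (ν n)) y) atTop (𝓝 (G y)))

end OrderedSelection

namespace OrderedSelection

/-! Drawing `k` points from `μ_ν` amounts to drawing `k` squares uniformly with replacement. If the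
squares are distinct, the pattern of the points is that of the chosen places, so the two densities
differ by at most the probability `1 - m.descFactorial k / m ^ k` of a repetition
(`abs_densityPermuton_sub_densitySel_le`). Since `m n → ∞`, pattern densities of `ν n` and of `μ_n`
have the same limits.

A `λ`-permuton has continuous marginals, so weak convergence of marginals to it is pointwise; this
gives one implication. For the other, compactness of the unit square yields a weakly convergent
subsequence of the `μ_n`. Its limit `μ` has as marginals the pointwise limits for the whole sequence
(`cdf_eq_of_tendsto`): `F_x` is explicit, and `F_y` inherits the slope bound `1 / λ`. Hence `μ` is a
`λ`-permuton. Continuous marginals make pattern events null on their frontier, so densities converge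
to those of `μ` along the subsequence, and along the whole sequence because they converge there by
assumption. -/

/-! ### Patterns of tuples of points -/

theorem strictMono_perm_unique {k : ℕ} {α : Type*} [LinearOrder α] {f : Fin k → α}
    {a a' : Equiv.Perm (Fin k)} (h : StrictMono fun i => f (a i))
    (h' : StrictMono fun i => f (a' i)) : a = a' := by
  have hr : Set.range (fun i => f (a i)) = Set.range fun i => f (a' i) := by
    rw [show (fun i => f (a i)) = f ∘ a from rfl, show (fun i => f (a' i)) = f ∘ a' from rfl,
      a.surjective.range_comp, a'.surjective.range_comp]
  have he := (h.range_inj h').1 hr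
  have hf : Function.Injective f := fun x y hxy => by
    have := h.injective (a₁ := a.symm x) (a₂ := a.symm y) (by simpa using hxy)
    simpa using this
  exact Equiv.ext fun i => hf (congrFun he i)

theorem HasPattern.unique {k : ℕ} {p : Fin k → ℝ × ℝ} {σ τ : Equiv.Perm (Fin k)}
    (hσ : HasPattern p σ) (hτ : HasPattern p τ) : σ = τ := by
  obtain ⟨a, b, ha, hb, h⟩ := hσ
  obtain ⟨a', b', ha', hb', h'⟩ := hτ
  obtain rfl := strictMono_perm_unique (f := fun i => (p i).1) ha ha'
  obtain rfl := strictMono_perm_unique (f := fun i => (p i).2) hb hb'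
  exact Equiv.ext fun i => b.injective ((h i).symm.trans (h' i))

theorem HasPattern.injective_fst {k : ℕ} {p : Fin k → ℝ × ℝ} {τ : Equiv.Perm (Fin k)}
    (h : HasPattern p τ) : Function.Injective fun i => (p i).1 := by
  obtain ⟨a, b, ha, -, -⟩ := h
  intro x y hxy
  have := ha.injective (a₁ := a.symm x) (a₂ := a.symm y) (by simpa using hxy)
  simpa using this

theorem exists_strictMono_perm {k : ℕ} {f : Fin k → ℝ} (hf : Function.Injective f) :
    ∃ a : Equiv.Perm (Fin k), StrictMono fun i => f (a i) :=
  ⟨Tuple.sort f, (Tuple.monotone_sort f).strictMono_of_injective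
    (hf.comp (Tuple.sort f).injective)⟩

theorem exists_hasPattern {k : ℕ} {p : Fin k → ℝ × ℝ}
    (h1 : Function.Injective fun i => (p i).1) (h2 : Function.Injective fun i => (p i).2) :
    ∃ σ, HasPattern p σ := by
  obtain ⟨a, ha⟩ := exists_strictMono_perm h1
  obtain ⟨b, hb⟩ := exists_strictMono_perm h2
  exact ⟨a.trans b.symm, a, b, ha, hb, fun i => by simp⟩

theorem HasPattern.of_lt_iff {k : ℕ} {p q : Fin k → ℝ × ℝ} {τ : Equiv.Perm (Fin k)}
    (h : HasPattern p τ) (h1 : ∀ i j, (p i).1 < (p j).1 → (q i).1 < (q j).1)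
    (h2 : ∀ i j, (p i).2 < (p j).2 → (q i).2 < (q j).2) : HasPattern q τ := by
  obtain ⟨a, b, ha, hb, h⟩ := h
  exact ⟨a, b, fun i j hij => h1 _ _ (ha hij), fun i j hij => h2 _ _ (hb hij), h⟩

/-! ### Pattern counting over ordered tuples of places -/

/-- The points of the grid selected by a tuple of places. -/
def gridPoints {k n m : ℕ} (ν : NMPerm n m) (f : Fin k → Fin m) : Fin k → ℝ × ℝ :=
  fun i => (((f i : ℕ) : ℝ), ((ν (f i) : ℕ) : ℝ))

theorem hasPattern_gridPoints_iff {k n m : ℕ} (ν : NMPerm n m)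
    (τ : Equiv.Perm (Fin k)) (f : Fin k → Fin m) :
    HasPattern (gridPoints ν f) τ ↔ ∃ (a : Equiv.Perm (Fin k)) (x : Fin k → Fin m),
      StrictMono x ∧ (∀ i j, ν (x i) < ν (x j) ↔ τ i < τ j) ∧ x ∘ a.symm = f := by
  constructor
  · rintro ⟨a, b, ha, hb, h⟩
    refine ⟨a, f ∘ a, fun i j hij => ?_, fun i j => ?_, ?_⟩
    · simpa [gridPoints] using ha hij
    · have := hb.lt_iff_lt (a := τ i) (b := τ j)
      simpa [gridPoints, h] using this
    · ext; simp
  · rintro ⟨a, x, hx, hτ, rfl⟩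
    refine ⟨a, τ.symm.trans a, fun i j hij => ?_, fun i j hij => ?_, fun i => by simp⟩
    · simpa [gridPoints] using hx hij
    · have := (hτ (τ.symm i) (τ.symm j)).2 (by simpa using hij)
      simpa [gridPoints] using this

/-- An injective tuple factors uniquely as an increasing tuple and a reordering, and the pattern
ignores the reordering; hence the factor `k!`. -/
theorem card_hasPattern_gridPoints {k n m : ℕ} (ν : NMPerm n m) (τ : Equiv.Perm (Fin k)) :
    Set.ncard {f : Fin k → Fin m | HasPattern (gridPoints ν f) τ} =
      k.factorial * occurrences τ ν := by
  have himage : {f : Fin k → Fin m | HasPattern (gridPoints ν f) τ} =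
      (fun q : Equiv.Perm (Fin k) × (Fin k → Fin m) => q.2 ∘ q.1.symm) ''
        (Set.univ ×ˢ {x : Fin k → Fin m | StrictMono x ∧
          ∀ i j, ν (x i) < ν (x j) ↔ τ i < τ j}) := by
    ext f
    simp only [Set.mem_ofPred_eq, hasPattern_gridPoints_iff, Set.mem_image, Set.mem_prod,
      Set.mem_univ, true_and, Prod.exists, and_assoc]
  rw [himage, Set.InjOn.ncard_image, Set.ncard_prod, Set.ncard_univ, Nat.card_perm,
    Nat.card_fin, occurrences]
  rintro ⟨a, x⟩ ⟨-, hx, -⟩ ⟨a', x'⟩ ⟨-, hx', -⟩ h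
  dsimp only at h hx hx'
  have ha : StrictMono fun i => (x ∘ a.symm) (a i) := by simpa using hx
  have ha' : StrictMono fun i => (x ∘ a.symm) (a' i) := by rw [h]; simpa using hx'
  obtain rfl := strictMono_perm_unique ha ha'
  have : x = x' := by
    ext i
    simpa using congrArg Fin.val (congrFun h (a i))
  rw [this]

theorem ncard_injective (k m : ℕ) :
    Set.ncard {f : Fin k → Fin m | Function.Injective f} = m.descFactorial k := by
  rw [← Nat.card_coe_set_eq, Set.coe_ofPred,
    Nat.card_congr (Equiv.subtypeInjectiveEquivEmbedding _ _), Nat.card_eq_fintype_card,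
    Fintype.card_embedding_eq]
  simp

theorem injective_of_hasPattern_gridPoints {k n m : ℕ} {ν : NMPerm n m}
    {τ : Equiv.Perm (Fin k)} {f : Fin k → Fin m} (h : HasPattern (gridPoints ν f) τ) :
    Function.Injective f := fun i j hij =>
  h.injective_fst (by simp [gridPoints, hij])

theorem densitySel_eq {k n m : ℕ} (ν : NMPerm n m) (τ : Equiv.Perm (Fin k)) :
    densitySel τ ν =
      (Set.ncard {f : Fin k → Fin m | HasPattern (gridPoints ν f) τ} : ℝ) /
        (m.descFactorial k : ℝ) := by
  rw [card_hasPattern_gridPoints, Nat.descFactorial_eq_factorial_mul_choose, densitySel]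
  push_cast
  rw [mul_div_mul_left _ _ (by positivity)]

/-! ### Cells of the sample space -/

/-- The cell of the tuples of points whose `i`-th entry lies in the square at place `f i`. -/
def cell {k n m : ℕ} (ν : NMPerm n m) (f : Fin k → Fin m) : Set (Fin k → ℝ × ℝ) :=
  Set.univ.pi fun i => gridSquare n (f i) (ν (f i))

theorem lt_of_mem_Ico_of_lt {n h l : ℕ} (hn : 0 < n) {x y : ℝ}
    (hx : x ∈ Set.Ico ((h : ℝ) / n) (((h : ℝ) + 1) / n))
    (hy : y ∈ Set.Ico ((l : ℝ) / n) (((l : ℝ) + 1) / n)) (hhl : h < l) : x < y := by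
  refine hx.2.trans_le (le_trans ?_ hy.1)
  have : (h : ℝ) + 1 ≤ l := by exact_mod_cast hhl
  gcongr

/-- Points in distinct squares of `ν` compare as the squares do in both coordinates; injectivity
excludes two points in one square, whose order would be free. -/
theorem hasPattern_iff_of_mem_cell {k n m : ℕ} (hn : 0 < n) {ν : NMPerm n m}
    {f : Fin k → Fin m} (hf : Function.Injective f) {p : Fin k → ℝ × ℝ} (hp : p ∈ cell ν f)
    (τ : Equiv.Perm (Fin k)) : HasPattern p τ ↔ HasPattern (gridPoints ν f) τ := by
  have hp' : ∀ i, p i ∈ gridSquare n (f i) (ν (f i)) := fun i => hp i (Set.mem_univ i)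
  have hx : ∀ i j, (f i : ℕ) < f j → (p i).1 < (p j).1 := fun i j h =>
    lt_of_mem_Ico_of_lt hn (hp' i).1 (hp' j).1 h
  have hy : ∀ i j, (ν (f i) : ℕ) < ν (f j) → (p i).2 < (p j).2 := fun i j h =>
    lt_of_mem_Ico_of_lt hn (hp' i).2 (hp' j).2 h
  constructor
  · refine fun h => h.of_lt_iff (fun i j hij => ?_) fun i j hij => ?_
    · rcases lt_trichotomy (f i : ℕ) (f j) with h | h | h
      · simpa [gridPoints] using h
      · rw [hf (Fin.ext h)] at hij; exact absurd hij (lt_irrefl _)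
      · exact absurd hij (hx _ _ h).not_gt
    · rcases lt_trichotomy (ν (f i) : ℕ) (ν (f j)) with h | h | h
      · simpa [gridPoints] using h
      · rw [hf (ν.injective (Fin.ext h))] at hij; exact absurd hij (lt_irrefl _)
      · exact absurd hij (hy _ _ h).not_gt
  · refine fun h => h.of_lt_iff (fun i j hij => hx i j ?_) fun i j hij => hy i j ?_
    · simpa [gridPoints] using hij
    · simpa [gridPoints] using hij

theorem measurableSet_gridSquare (n h l : ℕ) : MeasurableSet (gridSquare n h l) :=
  measurableSet_Ico.prod measurableSet_Ico

theorem measurableSet_cell {k n m : ℕ} (ν : NMPerm n m) (f : Fin k → Fin m) :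
    MeasurableSet (cell ν f) :=
  MeasurableSet.univ_pi fun _ => measurableSet_gridSquare _ _ _

theorem disjoint_Ico_div {n h l : ℕ} (hn : 0 < n) (hhl : h ≠ l) :
    Disjoint (Set.Ico ((h : ℝ) / n) (((h : ℝ) + 1) / n))
      (Set.Ico ((l : ℝ) / n) (((l : ℝ) + 1) / n)) := by
  rw [Set.disjoint_left]
  intro x hx hx'
  rcases hhl.lt_or_gt with h' | h'
  · exact lt_irrefl x (lt_of_mem_Ico_of_lt hn hx hx' h')
  · exact lt_irrefl x (lt_of_mem_Ico_of_lt hn hx' hx h')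

theorem disjoint_gridSquare {n m : ℕ} (hn : 0 < n) (ν : NMPerm n m) :
    Pairwise (Function.onFun Disjoint fun h : Fin m => gridSquare n h (ν h)) := fun _ _ hij =>
  Set.Disjoint.set_prod_left (disjoint_Ico_div hn fun h => hij (Fin.ext h)) _ _

theorem disjoint_cell {k n m : ℕ} (hn : 0 < n) (ν : NMPerm n m) :
    Pairwise (Function.onFun Disjoint fun f : Fin k → Fin m => cell ν f) := by
  intro f g hfg
  obtain ⟨i, hi⟩ := Function.ne_iff.1 hfg
  exact Set.disjoint_left.2 fun p hp hp' => Set.disjoint_left.1 (disjoint_gridSquare hn ν hi)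
    (hp i (Set.mem_univ i)) (hp' i (Set.mem_univ i))

/-! ### The measure of a selection and its marginals -/

theorem permutonOf_eq_sum {n m : ℕ} (hn : 0 < n) (ν : NMPerm n m) :
    permutonOf ν = ∑ h : Fin m, ENNReal.ofReal ((n : ℝ) ^ 2 / m) •
      (volume.restrict (Set.Ico (((h : ℕ) : ℝ) / n) ((((h : ℕ) : ℝ) + 1) / n))).prod
        (volume.restrict (Set.Ico (((ν h : ℕ) : ℝ) / n) ((((ν h : ℕ) : ℝ) + 1) / n))) := by
  have hU : MeasurableSet (⋃ h : Fin m, gridSquare n h (ν h)) :=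
    MeasurableSet.iUnion fun _ => measurableSet_gridSquare _ _ _
  have hdens : (fun p => ENNReal.ofReal (selDensity ν p)) =
      (⋃ h : Fin m, gridSquare n h (ν h)).indicator
        fun _ => ENNReal.ofReal ((n : ℝ) ^ 2 / m) := by
    ext p
    by_cases hp : p ∈ ⋃ h : Fin m, gridSquare n h (ν h) <;> simp [selDensity, hp]
  rw [permutonOf, hdens, withDensity_indicator hU, withDensity_const,
    Measure.restrict_iUnion (disjoint_gridSquare hn ν) fun _ => measurableSet_gridSquare _ _ _,
    Measure.sum_fintype, Finset.smul_sum]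
  simp only [Measure.prod_restrict, gridSquare, Measure.volume_eq_prod]

theorem volume_Ico_div (n h : ℕ) :
    volume (Set.Ico ((h : ℝ) / n) (((h : ℝ) + 1) / n)) = ENNReal.ofReal (1 / n) := by
  rw [Real.volume_Ico]; congr 1; ring

theorem ofReal_sq_div_mul {n m : ℕ} (hn : 0 < n) :
    ENNReal.ofReal ((n : ℝ) ^ 2 / m) * ENNReal.ofReal (1 / n) =
      ENNReal.ofReal ((n : ℝ) / m) := by
  rw [← ENNReal.ofReal_mul (by positivity)]
  congr 1
  field_simp

theorem map_fst_permutonOf {n m : ℕ} (hn : 0 < n) (ν : NMPerm n m) :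
    (permutonOf ν).map Prod.fst = ENNReal.ofReal ((n : ℝ) / m) •
      volume.restrict (⋃ h : Fin m,
        Set.Ico (((h : ℕ) : ℝ) / n) ((((h : ℕ) : ℝ) + 1) / n)) := by
  rw [permutonOf_eq_sum hn, Measure.map_finset_sum' (by fun_prop), Measure.restrict_iUnion
    (fun i j hij => disjoint_Ico_div hn fun h => hij (Fin.ext h)) fun _ => measurableSet_Ico,
    Measure.sum_fintype, Finset.smul_sum]
  refine Finset.sum_congr rfl fun h _ => ?_
  rw [Measure.map_smul, Measure.map_fst_prod, Measure.restrict_apply_univ, volume_Ico_div,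
    smul_smul, ofReal_sq_div_mul hn]

theorem map_snd_permutonOf {n m : ℕ} (hn : 0 < n) (ν : NMPerm n m) :
    (permutonOf ν).map Prod.snd = ENNReal.ofReal ((n : ℝ) / m) •
      volume.restrict (⋃ h : Fin m,
        Set.Ico (((ν h : ℕ) : ℝ) / n) ((((ν h : ℕ) : ℝ) + 1) / n)) := by
  rw [permutonOf_eq_sum hn, Measure.map_finset_sum' (by fun_prop), Measure.restrict_iUnion
    (fun i j hij => disjoint_Ico_div hn fun h => hij (ν.injective (Fin.ext h)))
      fun _ => measurableSet_Ico, Measure.sum_fintype, Finset.smul_sum]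
  refine Finset.sum_congr rfl fun h _ => ?_
  rw [Measure.map_smul, Measure.map_snd_prod, Measure.restrict_apply_univ, volume_Ico_div,
    smul_smul, ofReal_sq_div_mul hn]

theorem iUnion_Ico_div {n : ℕ} (m : ℕ) (hn : 0 < n) :
    (⋃ h : Fin m, Set.Ico (((h : ℕ) : ℝ) / n) ((((h : ℕ) : ℝ) + 1) / n)) =
      Set.Ico 0 ((m : ℝ) / n) := by
  have hn' : (0 : ℝ) < n := by exact_mod_cast hn
  ext x
  simp only [Set.mem_iUnion, Set.mem_Ico, div_le_iff₀ hn', lt_div_iff₀ hn']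
  constructor
  · rintro ⟨h, h1, h2⟩
    have : ((h : ℕ) : ℝ) + 1 ≤ m := by exact_mod_cast h.2
    exact ⟨by by_contra hx; nlinarith [(Nat.cast_nonneg (h : ℕ) : (0 : ℝ) ≤ _)], by linarith⟩
  · rintro ⟨h1, h2⟩
    have h0 : 0 ≤ x * n := by positivity
    exact ⟨⟨⌊x * n⌋₊, (Nat.floor_lt h0).2 h2⟩, Nat.floor_le h0, Nat.lt_floor_add_one _⟩

theorem isProbabilityMeasure_permutonOf {n m : ℕ} (hn : 0 < n) (hm : 0 < m) (ν : NMPerm n m) :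
    IsProbabilityMeasure (permutonOf ν) := by
  have : IsProbabilityMeasure ((permutonOf ν).map Prod.fst) := by
    constructor
    rw [map_fst_permutonOf hn, iUnion_Ico_div m hn, Measure.smul_apply,
      Measure.restrict_apply_univ, Real.volume_Ico, smul_eq_mul,
      ← ENNReal.ofReal_mul (by positivity), ← ENNReal.ofReal_one]
    congr 1
    field_simp
    simp
  exact Measure.isProbabilityMeasure_of_map Prod.fst

theorem permutonOf_gridSquare {n m : ℕ} (hn : 0 < n) (ν : NMPerm n m) (h : Fin m) :
    permutonOf ν (gridSquare n h (ν h)) = ENNReal.ofReal (1 / m) := by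
  rw [permutonOf_eq_sum hn, Measure.finsetSum_apply, Finset.sum_eq_single h]
  · rw [gridSquare, Measure.smul_apply, Measure.prod_prod, Measure.restrict_apply_self,
      Measure.restrict_apply_self, volume_Ico_div, volume_Ico_div, smul_eq_mul, ← mul_assoc,
      ofReal_sq_div_mul hn, ← ENNReal.ofReal_mul (by positivity)]
    congr 1
    field_simp
  · intro l _ hl
    rw [Measure.prod_restrict, Measure.smul_apply,
      Measure.restrict_apply (measurableSet_gridSquare _ _ _)]
    have := disjoint_gridSquare hn ν hl.symm
    rw [Function.onFun, Set.disjoint_iff_inter_eq_empty] at this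
    simp only [gridSquare] at this ⊢
    rw [this]; simp
  · simp

theorem permutonOf_compl_unit_square {n m : ℕ} (hn : 0 < n) (hmn : m ≤ n) (ν : NMPerm n m) :
    permutonOf ν (Set.Icc 0 1 ×ˢ Set.Icc 0 1)ᶜ = 0 := by
  have hn' : (0 : ℝ) < n := by exact_mod_cast hn
  rw [permutonOf_eq_sum hn, Measure.finsetSum_apply]
  refine Finset.sum_eq_zero fun h _ => ?_
  have hsub : ∀ l : ℕ, l < n →
      Set.Ico ((l : ℝ) / n) (((l : ℝ) + 1) / n) ⊆ Set.Icc 0 1 := fun l hl x hx =>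
    ⟨le_trans (by positivity) hx.1, hx.2.le.trans (by
      rw [div_le_one hn']; exact_mod_cast hl)⟩
  rw [Measure.prod_restrict, Measure.smul_apply, Measure.restrict_apply
    (measurableSet_Icc.prod measurableSet_Icc).compl]
  have : (Set.Icc (0 : ℝ) 1 ×ˢ Set.Icc (0 : ℝ) 1)ᶜ ∩
      (Set.Ico (((h : ℕ) : ℝ) / n) ((((h : ℕ) : ℝ) + 1) / n) ×ˢ
        Set.Ico (((ν h : ℕ) : ℝ) / n) ((((ν h : ℕ) : ℝ) + 1) / n)) = ∅ := by
    rw [← Set.disjoint_iff_inter_eq_empty, Set.disjoint_compl_left_iff_subset]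
    exact Set.prod_mono (hsub _ (h.2.trans_le hmn)) (hsub _ (ν h).2)
  rw [this]; simp

theorem margX_permutonOf {n m : ℕ} (hn : 0 < n) (hm : 0 < m) (ν : NMPerm n m) (x : ℝ) :
    margX (permutonOf ν) x = (n : ℝ) / m * max 0 (min x ((m : ℝ) / n)) := by
  have := isProbabilityMeasure_permutonOf hn hm ν
  have : IsProbabilityMeasure ((permutonOf ν).map Prod.fst) :=
    Measure.isProbabilityMeasure_map (by fun_prop)
  rw [margX, cdf_eq_real, map_fst_permutonOf hn, iUnion_Ico_div m hn, measureReal_ennreal_smul_apply,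
    measureReal_restrict_apply measurableSet_Iic, ENNReal.toReal_ofReal (by positivity)]
  have hae : (Set.Iic x ∩ Set.Ico 0 ((m : ℝ) / n) : Set ℝ) =ᵐ[volume]
      Set.Icc 0 (min x ((m : ℝ) / n)) := by
    have h : (Set.Icc 0 (min x ((m : ℝ) / n)) : Set ℝ) =
        Set.Iic x ∩ Set.Icc 0 ((m : ℝ) / n) := by
      ext; simp only [Set.mem_Icc, Set.mem_inter_iff, Set.mem_Iic, le_min_iff]; tauto
    rw [h]
    exact (ae_eq_refl _).inter Ico_ae_eq_Icc
  rw [measureReal_congr hae, Real.volume_real_Icc, sub_zero, max_comm]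

/-- The second marginal has density at most `n / m`; in the limit this becomes the slope bound `1 /
λ`. -/
theorem margY_permutonOf_sub_le {n m : ℕ} (hn : 0 < n) (hm : 0 < m) (ν : NMPerm n m) {a b : ℝ}
    (hab : a ≤ b) :
    margY (permutonOf ν) b - margY (permutonOf ν) a ≤ (n : ℝ) / m * (b - a) := by
  have := isProbabilityMeasure_permutonOf hn hm ν
  have : IsProbabilityMeasure ((permutonOf ν).map Prod.snd) :=
    Measure.isProbabilityMeasure_map (by fun_prop)
  have hIoc : margY (permutonOf ν) b - margY (permutonOf ν) a =
      ((permutonOf ν).map Prod.snd).real (Set.Ioc a b) := by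
    have hset : Set.Ioc a b = Set.Iic b \ Set.Iic a := by ext; simp [and_comm]
    rw [margY, margY, cdf_eq_real, cdf_eq_real, hset,
      measureReal_sdiff (Set.Iic_subset_Iic.2 hab) measurableSet_Iic]
  rw [hIoc, map_snd_permutonOf hn, measureReal_ennreal_smul_apply,
    measureReal_restrict_apply measurableSet_Ioc, ENNReal.toReal_ofReal (by positivity)]
  gcongr
  refine (measureReal_mono Set.inter_subset_left (by simp)).trans ?_
  rw [Real.volume_real_Ioc_of_le hab]

/-! ### Comparison of the two densities -/

/-- Sampling with replacement from the squares of `ν` compared with pattern counting in `ν`. -/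
theorem abs_densityPermuton_sub_densitySel_le {k n m : ℕ} (hn : 0 < n) (hm : 0 < m) (hk : k ≤ m)
    (ν : NMPerm n m) (τ : Equiv.Perm (Fin k)) :
    |densityPermuton τ (permutonOf ν) - densitySel τ ν| ≤
      1 - (m.descFactorial k : ℝ) / (m : ℝ) ^ k := by
  have := isProbabilityMeasure_permutonOf hn hm ν
  set P := Measure.pi fun _ : Fin k => permutonOf ν with hP
  have hm' : (0 : ℝ) < m := by exact_mod_cast hm
  have hcell : ∀ f : Fin k → Fin m, P.real (cell ν f) = (1 / (m : ℝ)) ^ k := by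
    intro f
    rw [measureReal_def, hP, cell, Measure.pi_pi]
    simp only [permutonOf_gridSquare hn, Finset.prod_const, Finset.card_univ, Fintype.card_fin]
    rw [ENNReal.toReal_pow, ENNReal.toReal_ofReal (by positivity)]
  have hunion : ∀ A : Set (Fin k → Fin m),
      P.real (⋃ f ∈ A, cell ν f) = (A.ncard : ℝ) / (m : ℝ) ^ k := by
    intro A
    have hA := A.toFinite
    rw [show (⋃ f ∈ A, cell ν f) = ⋃ f ∈ hA.toFinset, cell ν f by simp,
      measureReal_biUnion_finset (fun f _ g _ hfg => disjoint_cell hn ν hfg)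
        fun f _ => measurableSet_cell ν f]
    simp only [hcell, Finset.sum_const, nsmul_eq_mul]
    rw [Set.ncard_eq_toFinset_card A hA]
    simp [div_eq_mul_inv]
  set G := {f : Fin k → Fin m | HasPattern (gridPoints ν f) τ}
  set I := {f : Fin k → Fin m | Function.Injective f}
  have hGI : G ⊆ I := fun f hf => injective_of_hasPattern_gridPoints hf
  have hI : (I.ncard : ℝ) = m.descFactorial k := by rw [ncard_injective]
  have hG : (G.ncard : ℝ) ≤ m.descFactorial k := by
    rw [← hI]; exact_mod_cast Set.ncard_le_ncard hGI
  have hIc : (Iᶜ.ncard : ℝ) = (m : ℝ) ^ k - m.descFactorial k := by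
    have := Set.ncard_add_ncard_compl I
    rw [Nat.card_fun, Nat.card_fin, Nat.card_fin] at this
    rw [← hI, eq_sub_iff_add_eq']
    exact_mod_cast this
  have hD : (0 : ℝ) < m.descFactorial k := by
    exact_mod_cast Nat.descFactorial_pos.2 hk
  have hlow : (G.ncard : ℝ) / (m : ℝ) ^ k ≤ densityPermuton τ (permutonOf ν) := by
    rw [← hunion]
    refine measureReal_mono fun p hp => ?_
    simp only [Set.mem_iUnion] at hp
    obtain ⟨f, hf, hp⟩ := hp
    exact (hasPattern_iff_of_mem_cell hn (hGI hf) hp τ).2 hf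
  -- All cells of non-injective tuples are counted as if they had pattern `τ`; outside the cells
  -- there is no mass.
  have hup : densityPermuton τ (permutonOf ν) ≤
      (G.ncard : ℝ) / (m : ℝ) ^ k + ((m : ℝ) ^ k - m.descFactorial k) / (m : ℝ) ^ k := by
    have hnull : P.real (⋃ f ∈ (Set.univ : Set (Fin k → Fin m)), cell ν f)ᶜ = 0 := by
      rw [probReal_compl_eq_one_sub, hunion, Set.ncard_univ, Nat.card_fun, Nat.card_fin,
        Nat.card_fin]
      · push_cast; rw [div_self (by positivity), sub_self]
      · exact MeasurableSet.biUnion (Set.to_countable _) fun f _ => measurableSet_cell ν f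
    rw [← hIc, ← hunion, ← hunion]
    have hsub : {p | HasPattern p τ} ⊆ ((⋃ f ∈ G, cell ν f) ∪ ⋃ f ∈ Iᶜ, cell ν f) ∪
        (⋃ f ∈ (Set.univ : Set (Fin k → Fin m)), cell ν f)ᶜ := by
      intro p hp
      by_cases hpc : p ∈ ⋃ f ∈ (Set.univ : Set (Fin k → Fin m)), cell ν f
      · left
        simp only [Set.mem_univ, Set.iUnion_true, Set.mem_iUnion] at hpc
        obtain ⟨f, hf⟩ := hpc
        by_cases hfI : f ∈ I
        · left
          exact Set.mem_biUnion ((hasPattern_iff_of_mem_cell hn hfI hf τ).1 hp) hf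
        · right
          exact Set.mem_biUnion hfI hf
      · exact Or.inr hpc
    refine (measureReal_mono hsub).trans ((measureReal_union_le _ _).trans ?_)
    rw [hnull, add_zero]
    exact measureReal_union_le _ _
  rw [densitySel_eq]
  have hDm : (m.descFactorial k : ℝ) ≤ (m : ℝ) ^ k := by
    exact_mod_cast Nat.descFactorial_le_pow m k
  have hGD : (G.ncard : ℝ) / (m : ℝ) ^ k ≤ G.ncard / m.descFactorial k := by gcongr
  -- Changing the denominator costs the density, which is at most 1, times the repetition
  -- probability.
  have hdiff : (G.ncard : ℝ) / m.descFactorial k - G.ncard / (m : ℝ) ^ k ≤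
      1 - (m.descFactorial k : ℝ) / (m : ℝ) ^ k := by
    have h1 : (G.ncard : ℝ) / m.descFactorial k - G.ncard / (m : ℝ) ^ k =
        (G.ncard : ℝ) / m.descFactorial k * (1 - (m.descFactorial k : ℝ) / (m : ℝ) ^ k) := by
      field_simp
    rw [h1]
    exact mul_le_of_le_one_left (sub_nonneg.2 (div_le_one_of_le₀ hDm (by positivity)))
      (div_le_one_of_le₀ hG hD.le)
  rw [sub_div, div_self (by positivity)] at hup
  rw [abs_le]
  constructor <;> linarith

theorem tendsto_descFactorial_div_pow (k : ℕ) :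
    Tendsto (fun m : ℕ => (m.descFactorial k : ℝ) / (m : ℝ) ^ k) atTop (𝓝 1) := by
  refine (Asymptotics.isEquivalent_iff_tendsto_one ?_).1 (isEquivalent_descFactorial k)
  filter_upwards [eventually_gt_atTop 0] with m hm
  positivity

/-! ### Pattern events have null frontier -/

theorem measure_singleton_eq_zero_of_continuous_cdf (ρ : Measure ℝ) [IsProbabilityMeasure ρ]
    (h : Continuous (cdf ρ)) (x : ℝ) : ρ {x} = 0 := by
  rw [← measure_cdf ρ, StieltjesFunction.measure_singleton,
    h.continuousAt.continuousWithinAt.leftLim_eq, sub_self, ENNReal.ofReal_zero]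

/-- By independence the pair has a product law with atomless factors, and Fubini gives the diagonal
mass zero. -/
theorem pi_coincidence_eq_zero {k : ℕ} {μ : Measure (ℝ × ℝ)} [IsProbabilityMeasure μ]
    {g : ℝ × ℝ → ℝ} (hg : Measurable g) (h0 : ∀ x, μ.map g {x} = 0) {i j : Fin k} (hij : i ≠ j) :
    Measure.pi (fun _ : Fin k => μ) {p | g (p i) = g (p j)} = 0 := by
  have : IsProbabilityMeasure (μ.map g) := Measure.isProbabilityMeasure_map hg.aemeasurable
  have hind : IndepFun (fun p : Fin k → ℝ × ℝ => g (p i)) (fun p => g (p j))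
      (Measure.pi fun _ => μ) :=
    (iIndepFun_pi (μ := fun _ : Fin k => μ) (X := fun _ => g)
      fun _ => hg.aemeasurable).indepFun hij
  have hmap : ∀ l : Fin k, (Measure.pi fun _ : Fin k => μ).map (fun p => g (p l)) = μ.map g := by
    intro l
    have := (measurePreserving_eval (fun _ : Fin k => μ) l).map_eq
    conv_rhs => rw [← this, Measure.map_map hg (measurable_pi_apply l)]
    rfl
  have hgm : ∀ l : Fin k, Measurable fun p : Fin k → ℝ × ℝ => g (p l) :=
    fun l => hg.comp (measurable_pi_apply l)
  rw [indepFun_iff_map_prod_eq_prod_map_map (hgm i).aemeasurable (hgm j).aemeasurable, hmap, hmap] at hind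
  have hdiag : ((μ.map g).prod (μ.map g)) {q | q.1 = q.2} = 0 := by
    rw [Measure.measure_prod_null (measurableSet_eq_fun measurable_fst measurable_snd)]
    refine Eventually.of_forall fun x => ?_
    have : Prod.mk x ⁻¹' {q : ℝ × ℝ | q.1 = q.2} = {x} := by ext y; simp [eq_comm]
    simpa [this] using h0 x
  rw [← hind, Measure.map_apply ((hgm i).prodMk (hgm j))
    (measurableSet_eq_fun measurable_fst measurable_snd)] at hdiag
  exact hdiag

theorem isOpen_setOf_strictMono {k : ℕ} {g : ℝ × ℝ → ℝ} (hg : Continuous g)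
    (a : Equiv.Perm (Fin k)) :
    IsOpen {p : Fin k → ℝ × ℝ | StrictMono fun i => g (p (a i))} := by
  have : {p : Fin k → ℝ × ℝ | StrictMono fun i => g (p (a i))} =
      ⋂ i, ⋂ j, ⋂ _ : i < j, {p | g (p (a i)) < g (p (a j))} := by
    ext p; simp [StrictMono]
  rw [this]
  exact isOpen_iInter_of_finite fun i => isOpen_iInter_of_finite fun j =>
    isOpen_iInter_of_finite fun _ => isOpen_lt (by fun_prop) (by fun_prop)

theorem isOpen_setOf_hasPattern {k : ℕ} (τ : Equiv.Perm (Fin k)) :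
    IsOpen {p : Fin k → ℝ × ℝ | HasPattern p τ} := by
  have : {p : Fin k → ℝ × ℝ | HasPattern p τ} =
      ⋃ a : Equiv.Perm (Fin k), ⋃ b : Equiv.Perm (Fin k), ⋃ _ : ∀ i, a i = b (τ i),
        {p | StrictMono fun i => (p (a i)).1} ∩ {p | StrictMono fun i => (p (b i)).2} := by
    ext p
    simp only [HasPattern, Set.mem_ofPred_eq, Set.mem_iUnion, Set.mem_inter_iff]
    exact exists_congr fun a => exists_congr fun b => by tauto
  rw [this]
  exact isOpen_iUnion fun a => isOpen_iUnion fun b => isOpen_iUnion fun _ =>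
    (isOpen_setOf_strictMono continuous_fst a).inter (isOpen_setOf_strictMono continuous_snd b)

/-- A tuple without ties has some pattern `σ`, shared by a whole neighbourhood. If it is a limit of
tuples with pattern `τ`, then `σ = τ`, and it is interior. -/
theorem frontier_setOf_hasPattern_subset {k : ℕ} (τ : Equiv.Perm (Fin k)) :
    frontier {p : Fin k → ℝ × ℝ | HasPattern p τ} ⊆
      ⋃ i, ⋃ j, ⋃ _ : i ≠ j, {p | (p i).1 = (p j).1} ∪ {p | (p i).2 = (p j).2} := by
  intro p hp
  by_contra hne
  simp only [Set.mem_iUnion, Set.mem_union, Set.mem_ofPred_eq, not_exists, not_or] at hne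
  obtain ⟨σ, hσ⟩ := exists_hasPattern (p := p)
    (fun i j h => by_contra fun hij => (hne i j hij).1 h)
    (fun i j h => by_contra fun hij => (hne i j hij).2 h)
  rw [(isOpen_setOf_hasPattern τ).frontier_eq] at hp
  obtain ⟨q, hqσ, hqτ⟩ := mem_closure_iff.1 hp.1 _ (isOpen_setOf_hasPattern σ) hσ
  obtain rfl := HasPattern.unique hqσ hqτ
  exact hp.2 hσ

theorem pi_frontier_setOf_hasPattern {k : ℕ} {μ : Measure (ℝ × ℝ)} [IsProbabilityMeasure μ]
    (hX : Continuous (margX μ)) (hY : Continuous (margY μ)) (τ : Equiv.Perm (Fin k)) :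
    Measure.pi (fun _ : Fin k => μ) (frontier {p | HasPattern p τ}) = 0 := by
  have : IsProbabilityMeasure (μ.map Prod.fst) := Measure.isProbabilityMeasure_map (by fun_prop)
  have : IsProbabilityMeasure (μ.map Prod.snd) := Measure.isProbabilityMeasure_map (by fun_prop)
  refine measure_mono_null (frontier_setOf_hasPattern_subset τ) ?_
  simp only [measure_iUnion_null_iff]
  intro i j hij
  exact measure_union_null
    (pi_coincidence_eq_zero measurable_fst (measure_singleton_eq_zero_of_continuous_cdf _ hX) hij)
    (pi_coincidence_eq_zero measurable_snd (measure_singleton_eq_zero_of_continuous_cdf _ hY) hij)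

/-! ### Weak limits: densities, marginals, compactness -/

theorem tendsto_densityPermuton {P : ℕ → ProbabilityMeasure (ℝ × ℝ)}
    {μ : ProbabilityMeasure (ℝ × ℝ)} (h : Tendsto P atTop (𝓝 μ))
    (hX : Continuous (margX (μ : Measure (ℝ × ℝ)))) (hY : Continuous (margY (μ : Measure (ℝ × ℝ))))
    {k : ℕ} (τ : Equiv.Perm (Fin k)) :
    Tendsto (fun n => densityPermuton τ (P n : Measure (ℝ × ℝ))) atTop
      (𝓝 (densityPermuton τ (μ : Measure (ℝ × ℝ)))) := by
  have hpi : Tendsto (fun n => ProbabilityMeasure.pi fun _ : Fin k => P n) atTop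
      (𝓝 (ProbabilityMeasure.pi fun _ : Fin k => μ)) :=
    (ProbabilityMeasure.continuous_pi.tendsto _).comp (tendsto_pi_nhds.2 fun _ => h)
  have := ProbabilityMeasure.tendsto_measure_of_null_frontier_of_tendsto' hpi
    (E := {p | HasPattern p τ}) (by simpa using pi_frontier_setOf_hasPattern hX hY τ)
  exact (ENNReal.tendsto_toReal (measure_ne_top _ _)).comp this

/-- Portmanteau on the closed ray at `x` gives `≥`; on open rays at `y > x` it gives the bound `G
y`, and `y ↓ x` finishes by continuity of `G`. -/
theorem cdf_eq_of_tendsto {ρs : ℕ → ProbabilityMeasure ℝ} {ρ : ProbabilityMeasure ℝ}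
    (h : Tendsto ρs atTop (𝓝 ρ)) {G : ℝ → ℝ} (hG : Continuous G)
    (hlim : ∀ x, Tendsto (fun n => cdf (ρs n : Measure ℝ) x) atTop (𝓝 (G x))) (x : ℝ) :
    cdf (ρ : Measure ℝ) x = G x := by
  have hlim' : ∀ x, Tendsto (fun n => (ρs n : Measure ℝ) (Set.Iic x)) atTop
      (𝓝 (ENNReal.ofReal (G x))) := fun x => by
    simp only [← ofReal_cdf]
    exact (ENNReal.continuous_ofReal.tendsto _).comp (hlim x)
  have hG0 : ∀ x, 0 ≤ G x := fun x => ge_of_tendsto' (hlim x) fun n => cdf_nonneg _ x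
  apply le_antisymm
  · have hle : ∀ y, x < y → cdf (ρ : Measure ℝ) x ≤ G y := by
      intro y hxy
      rw [← ENNReal.ofReal_le_ofReal_iff (hG0 y), ofReal_cdf]
      calc (ρ : Measure ℝ) (Set.Iic x) ≤ (ρ : Measure ℝ) (Set.Iio y) :=
            measure_mono (Set.Iic_subset_Iio.2 hxy)
        _ ≤ atTop.liminf fun n => (ρs n : Measure ℝ) (Set.Iio y) :=
            ProbabilityMeasure.le_liminf_measure_open_of_tendsto h isOpen_Iio
        _ ≤ atTop.liminf fun n => (ρs n : Measure ℝ) (Set.Iic y) :=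
            liminf_le_liminf (Eventually.of_forall fun n => measure_mono Set.Iio_subset_Iic_self)
        _ = ENNReal.ofReal (G y) := (hlim' y).liminf_eq
    exact ge_of_tendsto (hG.continuousWithinAt (s := Set.Ioi x) (x := x))
      (eventually_nhdsWithin_of_forall fun y hy => hle y hy)
  · rw [← ENNReal.ofReal_le_ofReal_iff (cdf_nonneg _ x), ofReal_cdf, ← (hlim' x).limsup_eq]
    exact ProbabilityMeasure.limsup_measure_closed_le_of_tendsto h isClosed_Iic

theorem exists_subseq_tendsto_of_unit_square {P : ℕ → ProbabilityMeasure (ℝ × ℝ)}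
    (hP : ∀ n, (P n : Measure (ℝ × ℝ)) (Set.Icc 0 1 ×ˢ Set.Icc 0 1)ᶜ = 0) :
    ∃ (μ : ProbabilityMeasure (ℝ × ℝ)) (φ : ℕ → ℕ), StrictMono φ ∧
      Tendsto (P ∘ φ) atTop (𝓝 μ) ∧
      (μ : Measure (ℝ × ℝ)) (Set.Icc 0 1 ×ˢ Set.Icc 0 1)ᶜ = 0 := by
  have hK : IsCompact (Set.Icc (0 : ℝ) 1 ×ˢ Set.Icc (0 : ℝ) 1) := isCompact_Icc.prod isCompact_Icc
  have hcomp : IsCompact (closure (Set.range P)) := by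
    refine isCompact_closure_of_isTightMeasureSet
      (isTightMeasureSet_iff_exists_isCompact_measure_compl_le.2 fun ε _ => ⟨_, hK, ?_⟩)
    rintro _ ⟨_, ⟨n, rfl⟩, rfl⟩
    rw [hP]; exact zero_le
  obtain ⟨μ, -, φ, hφ, hlim⟩ := hcomp.tendsto_subseq fun n => subset_closure (Set.mem_range_self n)
  refine ⟨μ, φ, hφ, hlim, le_antisymm ?_ zero_le⟩
  refine (ProbabilityMeasure.le_liminf_measure_open_of_tendsto hlim
    hK.isClosed.isOpen_compl).trans ?_
  simp only [Function.comp_apply, hP, liminf_const, le_refl]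

/-! ### Marginals of permutons and their limits -/

theorem margX_eq_of_isLambdaPermuton {lam : ℝ} {μ : Measure (ℝ × ℝ)}
    (h : IsLambdaPermuton lam μ) (x : ℝ) : margX μ x = lam⁻¹ * max 0 (min x lam) := by
  have := h.isProbabilityMeasure
  have : IsProbabilityMeasure (μ.map Prod.fst) := Measure.isProbabilityMeasure_map (by fun_prop)
  have hpos := h.pos
  rcases lt_or_ge x 0 with hx | hx
  · rw [min_eq_left (hx.trans hpos).le, max_eq_left hx.le, mul_zero, margX, cdf_eq_real,
      measureReal_def, Measure.map_apply measurable_fst measurableSet_Iic,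
      measure_mono_null _ h.concentrated, ENNReal.toReal_zero]
    intro p hp hp'
    exact absurd (hp'.1.1.trans hp) hx.not_ge
  · rcases le_or_gt x lam with hxl | hxl
    · rw [h.margX_eq x ⟨hx, hxl⟩, min_eq_left hxl, max_eq_right hx, div_eq_inv_mul]
    · rw [min_eq_right hxl.le, max_eq_right hpos.le, inv_mul_cancel₀ hpos.ne']
      refine le_antisymm (cdf_le_one _ x) ?_
      calc (1 : ℝ) = margX μ lam := by
            rw [h.margX_eq lam ⟨hpos.le, le_rfl⟩, div_self hpos.ne']
        _ ≤ margX μ x := monotone_cdf _ hxl.le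

theorem continuous_margX_of_isLambdaPermuton {lam : ℝ} {μ : Measure (ℝ × ℝ)}
    (h : IsLambdaPermuton lam μ) : Continuous (margX μ) := by
  rw [funext (margX_eq_of_isLambdaPermuton h)]
  fun_prop

theorem tendsto_margX_permutonOf {m : ℕ → ℕ} (hm : ∀ n, 1 ≤ n → 1 ≤ m n ∧ m n ≤ n) {lam : ℝ}
    (hlam : 0 < lam) (hlim : Tendsto (fun n : ℕ => (m n : ℝ) / (n : ℝ)) atTop (𝓝 lam))
    (ν : ∀ n, NMPerm n (m n)) (x : ℝ) :
    Tendsto (fun n => margX (permutonOf (ν n)) x) atTop (𝓝 (lam⁻¹ * max 0 (min x lam))) := by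
  have h : Tendsto (fun n : ℕ => ((m n : ℝ) / n)⁻¹ * max 0 (min x ((m n : ℝ) / n))) atTop
      (𝓝 (lam⁻¹ * max 0 (min x lam))) :=
    (hlim.inv₀ hlam.ne').mul (tendsto_const_nhds.max (tendsto_const_nhds.min hlim))
  refine h.congr' ?_
  filter_upwards [eventually_ge_atTop 1] with n hn
  rw [margX_permutonOf hn (hm n hn).1, inv_div]

theorem tendsto_densityPermuton_sub_densitySel {m : ℕ → ℕ}
    (hm : ∀ n, 1 ≤ n → 1 ≤ m n ∧ m n ≤ n) (hm_top : Tendsto m atTop atTop)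
    (ν : ∀ n, NMPerm n (m n)) {k : ℕ} (τ : Equiv.Perm (Fin k)) :
    Tendsto (fun n => densityPermuton τ (permutonOf (ν n)) - densitySel τ (ν n)) atTop (𝓝 0) := by
  have h := ((tendsto_descFactorial_div_pow k).comp hm_top).const_sub 1
  rw [sub_self] at h
  refine squeeze_zero_norm' ?_ h
  filter_upwards [eventually_ge_atTop 1, hm_top.eventually_ge_atTop k] with n hn hk
  exact abs_densityPermuton_sub_densitySel_le hn (hm n hn).1 hk (ν n) τ

/-- Pointwise limits of the second marginal distribution functions are Lipschitz. -/
theorem sub_le_of_tendsto_margY {m : ℕ → ℕ} (hm : ∀ n, 1 ≤ n → 1 ≤ m n ∧ m n ≤ n) {lam : ℝ}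
    (hlam : 0 < lam) (hlim : Tendsto (fun n : ℕ => (m n : ℝ) / (n : ℝ)) atTop (𝓝 lam))
    (ν : ∀ n, NMPerm n (m n)) {G : ℝ → ℝ}
    (hG : ∀ y, Tendsto (fun n => margY (permutonOf (ν n)) y) atTop (𝓝 (G y))) {a b : ℝ}
    (hab : a ≤ b) : G b - G a ≤ (b - a) / lam := by
  have h : Tendsto (fun n : ℕ => ((m n : ℝ) / n)⁻¹ * (b - a)) atTop (𝓝 ((b - a) / lam)) := by
    rw [div_eq_inv_mul]
    exact (hlim.inv₀ hlam.ne').mul_const _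
  refine le_of_tendsto_of_tendsto ((hG b).sub (hG a)) h ?_
  filter_upwards [eventually_ge_atTop 1] with n hn
  rw [inv_div]
  exact margY_permutonOf_sub_le hn (hm n hn).1 (ν n) hab

theorem continuous_of_tendsto_margY {m : ℕ → ℕ} (hm : ∀ n, 1 ≤ n → 1 ≤ m n ∧ m n ≤ n) {lam : ℝ}
    (hlam : 0 < lam) (hlim : Tendsto (fun n : ℕ => (m n : ℝ) / (n : ℝ)) atTop (𝓝 lam))
    (ν : ∀ n, NMPerm n (m n)) {G : ℝ → ℝ}
    (hG : ∀ y, Tendsto (fun n => margY (permutonOf (ν n)) y) atTop (𝓝 (G y))) :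
    Continuous G := by
  refine (LipschitzWith.of_le_add_mul (Real.toNNReal lam⁻¹) fun x y => ?_).continuous
  rw [Real.coe_toNNReal _ (by positivity), Real.dist_eq]
  -- Only the one-sided bound is needed: monotonicity gives it for `x ≤ y`, the slope bound for `y ≤
  -- x`.
  rcases le_total x y with hxy | hxy
  · have hmono : G x ≤ G y :=
      le_of_tendsto_of_tendsto' (hG x) (hG y) fun n => monotone_cdf _ hxy
    have : 0 ≤ lam⁻¹ * |x - y| := by positivity
    linarith
  · have := sub_le_of_tendsto_margY hm hlam hlim ν hG hxy
    rw [abs_of_nonneg (sub_nonneg.2 hxy), ← div_eq_inv_mul]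
    linarith

/-! ### The two implications -/

theorem isConvergent_of_tConv {m : ℕ → ℕ} (hm : ∀ n, 1 ≤ n → 1 ≤ m n ∧ m n ≤ n)
    (hm_top : Tendsto m atTop atTop) {lam : ℝ} (ν : ∀ n, NMPerm n (m n)) {μ : Measure (ℝ × ℝ)}
    (hμ : IsLambdaPermuton lam μ) (h : TConv (fun n => permutonOf (ν n)) μ) :
    IsConvergent ν := by
  refine ⟨fun k hk τ => ⟨densityPermuton τ μ, ?_⟩,
    ⟨margX μ, fun x => h.2.1 x (continuous_margX_of_isLambdaPermuton hμ).continuousAt⟩,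
    ⟨margY μ, fun y => h.2.2 y hμ.margY_continuous.continuousAt⟩⟩
  simpa using (h.1 k hk τ).sub (tendsto_densityPermuton_sub_densitySel hm hm_top ν τ)

theorem exists_tConv_of_isConvergent {m : ℕ → ℕ} (hm : ∀ n, 1 ≤ n → 1 ≤ m n ∧ m n ≤ n)
    (hm_top : Tendsto m atTop atTop) {lam : ℝ} (hlam : 0 < lam)
    (hlim : Tendsto (fun n : ℕ => (m n : ℝ) / (n : ℝ)) atTop (𝓝 lam))
    (ν : ∀ n, NMPerm n (m n)) (h : IsConvergent ν) :
    ∃ μ : Measure (ℝ × ℝ), IsLambdaPermuton lam μ ∧ TConv (fun n => permutonOf (ν n)) μ := by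
  obtain ⟨hdens, -, G, hG⟩ := h
  have hGc := continuous_of_tendsto_margY hm hlam hlim ν hG
  have hlam1 : lam ≤ 1 := by
    refine le_of_tendsto hlim ?_
    filter_upwards [eventually_ge_atTop 1] with n hn
    exact div_le_one_of_le₀ (by exact_mod_cast (hm n hn).2) (by positivity)
  -- The index is shifted because at `n = 0` the measure is zero, not a probability measure.
  let P : ℕ → ProbabilityMeasure (ℝ × ℝ) := fun n => ⟨permutonOf (ν (n + 1)),
    isProbabilityMeasure_permutonOf n.succ_pos (hm _ n.succ_pos).1 _⟩
  obtain ⟨μ, φ, hφ, hconv, hsq⟩ := exists_subseq_tendsto_of_unit_square (P := P)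
    fun n => permutonOf_compl_unit_square n.succ_pos (hm _ n.succ_pos).2 _
  have hφ1 : Tendsto (fun n => φ n + 1) atTop atTop := (tendsto_add_atTop_nat 1).comp hφ.tendsto_atTop
  have hX : ∀ x, margX (μ : Measure (ℝ × ℝ)) x = lam⁻¹ * max 0 (min x lam) :=
    cdf_eq_of_tendsto (ProbabilityMeasure.tendsto_map_of_tendsto_of_continuous _ _ hconv
      continuous_fst) (by fun_prop)
      fun x => (tendsto_margX_permutonOf hm hlam hlim ν x).comp hφ1
  have hY : ∀ y, margY (μ : Measure (ℝ × ℝ)) y = G y :=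
    cdf_eq_of_tendsto (ProbabilityMeasure.tendsto_map_of_tendsto_of_continuous _ _ hconv
      continuous_snd) hGc fun y => (hG y).comp hφ1
  have hXc : Continuous (margX (μ : Measure (ℝ × ℝ))) := by
    rw [funext hX]; fun_prop
  have hYc : Continuous (margY (μ : Measure (ℝ × ℝ))) := by
    rw [funext hY]; exact hGc
  -- `F_x` already equals 1 at `lam`; the other three sides of the rectangle come from the unit
  -- square.
  have hright : (μ : Measure (ℝ × ℝ)) {p | lam < p.1} = 0 := by
    have : IsProbabilityMeasure ((μ : Measure (ℝ × ℝ)).map Prod.fst) :=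
      Measure.isProbabilityMeasure_map (by fun_prop)
    have h1 := hX lam
    rw [min_self, max_eq_right hlam.le, inv_mul_cancel₀ hlam.ne', margX, cdf_eq_real] at h1
    have h2 := probReal_compl_eq_one_sub (μ := (μ : Measure (ℝ × ℝ)).map Prod.fst)
      (measurableSet_Iic (a := lam))
    rw [h1, sub_self, Set.compl_Iic, measureReal_eq_zero_iff,
      Measure.map_apply measurable_fst measurableSet_Ioi] at h2
    exact h2
  refine ⟨μ, ⟨inferInstance, hlam, hlam1, ?_, fun x hx => ?_, hYc, fun a b _ hab _ => ?_⟩,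
    fun k hk τ => ?_, fun x _ => ?_, fun y _ => ?_⟩
  · refine measure_mono_null (fun p hp => ?_) (measure_union_null hright hsq)
    by_contra hp'
    simp only [Set.mem_union, Set.mem_ofPred_eq, Set.mem_compl_iff, not_or, not_lt, not_not]
      at hp'
    exact hp ⟨⟨hp'.2.1.1, hp'.1⟩, hp'.2.2⟩
  · rw [hX, min_eq_left hx.2, max_eq_right hx.1, div_eq_inv_mul]
  · rw [hY, hY]
    exact sub_le_of_tendsto_margY hm hlam hlim ν hG hab.le
  -- The limit exists along the whole sequence, so the subsequence suffices to identify it.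
  · obtain ⟨c, hc⟩ := hdens k hk τ
    have hfull : Tendsto (fun n => densityPermuton τ (permutonOf (ν n))) atTop (𝓝 c) := by
      simpa using hc.add (tendsto_densityPermuton_sub_densitySel hm hm_top ν τ)
    rwa [← tendsto_nhds_unique (hfull.comp hφ1) (tendsto_densityPermuton hconv hXc hYc τ)]
  · rw [hX]
    exact tendsto_margX_permutonOf hm hlam hlim ν x
  · rw [hY]
    exact hG y

end OrderedSelection

theorem mainTheorem3 (m : ℕ → ℕ) (hm : ∀ n, 1 ≤ n → 1 ≤ m n ∧ m n ≤ n)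
    (hm_top : Tendsto m atTop atTop)
    (lam : ℝ) (hlam : 0 < lam)
    (hlim : Tendsto (fun n : ℕ => (m n : ℝ) / (n : ℝ)) atTop (𝓝 lam))
    (ν : ∀ n, OrderedSelection.NMPerm n (m n)) :
    OrderedSelection.IsConvergent ν ↔
      ∃ μ : Measure (ℝ × ℝ), OrderedSelection.IsLambdaPermuton lam μ ∧
        OrderedSelection.TConv (fun n => OrderedSelection.permutonOf (ν n)) μ :=
  ⟨OrderedSelection.exists_tConv_of_isConvergent hm hm_top hlam hlim ν, fun ⟨_, hμ, h⟩ =>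
    OrderedSelection.isConvergent_of_tConv hm hm_top ν hμ h⟩
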